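/- Let $K$ be a field of characteristic $p>0$, let $K^{p^n}=\{x^{p^n}:x\in K\}$ and $k=\bigcap_{n\ge 0}K^{p^n}$, and assume that $K/k$ is a finitely generated field extension. Definitions. For a subfield $L\subset K$ let $TL$ be the $L$-space of derivations $L\to L$, and for $M\subset L$ let $T_{L/M}\subset TL$ be the derivations vanishing on $M$. A $p$-Lie algebra on $L$ is an $L$-subspace $\mathcal F\subset TL$ closed under the Lie bracket and under $D\mapsto D^{p}$; put $\operatorname{Ann}(\mathcal F)=\{x\in L: D(x)=0 \text{ for all } D\in\mathcal F\}$. For a subfield $W\subset K$, let $J$ be the kernel of multiplication $K\otimes_W K\to K$; $\operatorname{Diff}_W(K)$ is the union over $n\ge 0$ of the spaces $\operatorname{Hom}_K(K\otimes_W K/J^{n+1},K)$ ($K$ acting on the left factor), a functional $\varphi$ being identified with the operator $x\mapsto\varphi(1\otimes x)$ on $K$. For an operator $D$ on $K$, $d(K/L)(D)$ is its restriction to $L$, an operator $L\to K$; derivations of $L$ are also regarded as operators $L\to K$. Consider the following three kinds of data on $K$. 1. Power towers: sequences of subfields $W_0,W_1,W_2,\dots$ of $K$ with $W_j=W_i\cdot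 K^{p^j}$ whenever $j\le i$. 2. Jacobson sequences: sequences $(\mathcal F_1,\mathcal F_2,\dots)$ where $\mathcal F_1$ is a $p$-Lie algebra on $K$ and, for $i\ge 1$, $\mathcal F_{i+1}$ is a $p$-Lie algebra on $\operatorname{Ann}(\mathcal F_i)$ with $\mathcal F_{i+1}\cap T_{\operatorname{Ann}(\mathcal F_i)/K^{p^i}}=0$. 3. $K$-subalgebras $K\subset\mathcal D\subset\operatorname{Diff}_k(K)$, i.e. rings of operators under composition, containing the multiplications by elements of $K$ and contained in $\operatorname{Diff}_k(K)$. There are bijections between these three kinds of data, compatible with each other, given as follows: - from 1 to 2, by $W_\bullet\mapsto(T_{W_0/W_1},T_{W_1/W_2},T_{W_2/W_3},\dots)$; - from 2 to 1 (inverse to the previous map), by $W_0=K$ and $W_n=\operatorname{Ann}(\mathcal F_n)$ for $n\ge 1$; - from 1 to 3, by $W_\bullet\mapsto\bigcup_{n\ge 0}\operatorname{Diff}_{W_n}(K)$; - from 3 to 2, by unpacking: $\mathcal F_n=d(K/W_{n-1})(\mathcal D)\cap TW_{n-1}$ for $n\ge 1$, where $W_0=K$ and $W_n=\operatorname{Ann}(\mathcal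 F_n)$; these $W_n$ form the power tower corresponding to $\mathcal D$. Moreover, for corresponding $W_\bullet$ and $(\mathcal F_i)$, the ranks $\operatorname{rk}(\mathcal F_i)=\dim_{W_{i-1}}(\mathcal F_i)$, $i\ge 1$, are finite and nonincreasing, $\operatorname{rk}(\mathcal F_i)\ge\operatorname{rk}(\mathcal F_{i+1})$, and $p^{\operatorname{rk}(\mathcal F_i)}=[W_{i-1}:W_i]$. -/

import Mathlib

open scoped TensorProduct

namespace DiffCorr

/-! ## Subfields of `p`-powers and power towers -/

section Fields

variable (p : ℕ) (K : Type*) [Field K] [Fact p.Prime] [CharP K p]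

/-- The subfield `K^{p^n}` of `p^n`-th powers of elements of `K`. -/
noncomputable def powField (n : ℕ) : Subfield K := (iterateFrobenius K p n).fieldRange

/-- The subfield `K^{p^∞} = ⋂ₙ K^{p^n}`. -/
noncomputable def perfField : Subfield K := ⨅ n : ℕ, powField p K n

/-- A power tower on `K`: subfields `W 0, W 1, …` of `K` with `W j = W i · K^{p^j}` for `j ≤ i`. -/
structure PowerTower where
  /-- the members of the tower -/
  W : ℕ → Subfield K
  eq_sup : ∀ i j : ℕ, j ≤ i → W j = W i ⊔ powField p K j

end Fields

/-! ## Derivations, relative tangent spaces and `p`-Lie algebras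

For a subfield `L` of `K`, the tangent space `TL` is `Derivation ℤ L L`, the space of all additive
derivations `L → L`. In characteristic `p` such a derivation kills `L^p`, so it is linear over
every perfect subfield of `L`. -/

section Derivations

variable (p : ℕ) {F : Type*} [Field F] [Fact p.Prime] [CharP F p]

theorem iterate_derivation_mul (δ : Derivation ℤ F F) (a b : F) :
    ((δ : F →ₗ[ℤ] F) ^ p) (a * b) =
      a * ((δ : F →ₗ[ℤ] F) ^ p) b + b * ((δ : F →ₗ[ℤ] F) ^ p) a := by
  set d : Module.End ℤ F := (δ : F →ₗ[ℤ] F) with hd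
  let A : Module.End ℤ (F ⊗[ℤ] F) := TensorProduct.map d LinearMap.id
  let B : Module.End ℤ (F ⊗[ℤ] F) := TensorProduct.map LinearMap.id d
  have hA : ∀ (n : ℕ) (x y : F), (A ^ n) (x ⊗ₜ[ℤ] y) = ((d ^ n) x) ⊗ₜ[ℤ] y := by
    intro n
    induction n with
    | zero => intro x y; simp
    | succ n ih =>
      intro x y
      rw [pow_succ', pow_succ', Module.End.mul_apply, Module.End.mul_apply, ih]
      rfl
  have hB : ∀ (n : ℕ) (x y : F), (B ^ n) (x ⊗ₜ[ℤ] y) = x ⊗ₜ[ℤ] ((d ^ n) y) := by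
    intro n
    induction n with
    | zero => intro x y; simp
    | succ n ih =>
      intro x y
      rw [pow_succ', pow_succ', Module.End.mul_apply, Module.End.mul_apply, ih]
      rfl
  have hAB : Commute A B := by
    apply TensorProduct.ext'
    intro x y
    rfl
  have hm : ∀ (n : ℕ) (t : F ⊗[ℤ] F),
      LinearMap.mul' ℤ F (((A + B) ^ n) t) = (d ^ n) (LinearMap.mul' ℤ F t) := by
    have h1 : ∀ t : F ⊗[ℤ] F,
        LinearMap.mul' ℤ F ((A + B) t) = d (LinearMap.mul' ℤ F t) := by
      intro t
      induction t using TensorProduct.induction_on with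
      | zero => simp
      | tmul x y =>
        change LinearMap.mul' ℤ F ((δ x) ⊗ₜ[ℤ] y + x ⊗ₜ[ℤ] (δ y)) = δ (x * y)
        rw [map_add, LinearMap.mul'_apply, LinearMap.mul'_apply, Derivation.leibniz, smul_eq_mul,
          smul_eq_mul]
        ring
      | add x y hx hy => rw [map_add, map_add, hx, hy, map_add, map_add]
    intro n
    induction n with
    | zero => intro t; simp
    | succ n ih =>
      intro t
      rw [pow_succ', pow_succ', Module.End.mul_apply, Module.End.mul_apply, h1, ih]
  obtain ⟨r, hr⟩ := hAB.exists_add_pow_prime_eq (Fact.out : p.Prime)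
  have key := hm p (a ⊗ₜ[ℤ] b)
  rw [hr] at key
  have hp : LinearMap.mul' ℤ F (((p : Module.End ℤ (F ⊗[ℤ] F)) * A * B * r) (a ⊗ₜ[ℤ] b)) = 0 := by
    rw [mul_assoc, mul_assoc, Module.End.mul_apply, Module.End.natCast_apply, map_nsmul]
    simp
  rw [LinearMap.add_apply, map_add, hp, add_zero, LinearMap.add_apply, map_add, hA, hB] at key
  simp only [LinearMap.mul'_apply] at key
  rw [← key]
  ring

/-- The `p`-th iterate of a derivation in characteristic `p`, which is again a derivation. -/
def pPow (δ : Derivation ℤ F F) : Derivation ℤ F F :=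
  Derivation.mk' ((δ : F →ₗ[ℤ] F) ^ p) (iterate_derivation_mul p δ)

theorem pPow_apply (δ : Derivation ℤ F F) (x : F) : pPow p δ x = (⇑δ)^[p] x := by
  change ((δ : F →ₗ[ℤ] F) ^ p) x = _
  rw [Module.End.pow_apply]
  rfl

end Derivations

section Tangent

variable (p : ℕ) {K : Type*} [Field K] [Fact p.Prime] [CharP K p]

/-- The relative tangent space `T_{L/M}`: the derivations of `L` that vanish on `M`. -/
def relTangent (L M : Subfield K) : Submodule L (Derivation ℤ L L) where
  carrier := {δ | ∀ x : L, (x : K) ∈ M → δ x = 0}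
  zero_mem' := fun x _ => rfl
  add_mem' := fun {a b} ha hb x hx => by simp [ha x hx, hb x hx]
  smul_mem' := fun c a ha x hx => by simp [ha x hx]

variable (K) in
/-- A `p`-Lie algebra on a subfield `base` of `K`: a `base`-subspace of the tangent space of `base`
that is closed under the Lie bracket and under `p`-th powers. -/
structure PLieAlg where
  /-- the field on which the `p`-Lie algebra lives -/
  base : Subfield K
  /-- the underlying space of derivations of `base` -/
  space : Submodule base (Derivation ℤ base base)
  lie_mem : ∀ δ ∈ space, ∀ ε ∈ space, ⁅δ, ε⁆ ∈ space
  pPow_mem : ∀ δ ∈ space, pPow p δ ∈ space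

/-- The relative tangent bundle `T_{L/M}` as a `p`-Lie algebra on `L`. -/
def relTangentAlg (L M : Subfield K) : PLieAlg p K where
  base := L
  space := relTangent L M
  lie_mem := fun δ hδ ε hε x hx => by
    rw [Derivation.commutator_apply, hδ x hx, hε x hx, map_zero, map_zero, sub_zero]
  pPow_mem := fun δ hδ x hx => by
    obtain ⟨n, hn⟩ := Nat.exists_eq_succ_of_ne_zero (Fact.out : p.Prime).ne_zero
    rw [pPow_apply]
    nth_rewrite 1 [hn]
    rw [Function.iterate_succ_apply, hδ x hx]
    exact Function.iterate_fixed (map_zero δ) n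

variable {p}

/-- `Ann(𝓕)`: the subfield of elements of the base that are killed by all members of `𝓕`. -/
def PLieAlg.ann (𝓕 : PLieAlg p K) : Subfield K where
  carrier := {x | ∃ h : x ∈ 𝓕.base, ∀ δ ∈ 𝓕.space, δ ⟨x, h⟩ = 0}
  zero_mem' := ⟨zero_mem _, fun δ _ => map_zero δ⟩
  one_mem' := ⟨one_mem _, fun δ _ => δ.map_one_eq_zero⟩
  add_mem' := by
    rintro x y ⟨hx, hx'⟩ ⟨hy, hy'⟩
    refine ⟨add_mem hx hy, fun δ hδ => ?_⟩
    have := map_add δ ⟨x, hx⟩ ⟨y, hy⟩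
    rwa [hx' δ hδ, hy' δ hδ, add_zero] at this
  neg_mem' := by
    rintro x ⟨hx, hx'⟩
    refine ⟨neg_mem hx, fun δ hδ => ?_⟩
    have := map_neg δ ⟨x, hx⟩
    rwa [hx' δ hδ, neg_zero] at this
  mul_mem' := by
    rintro x y ⟨hx, hx'⟩ ⟨hy, hy'⟩
    refine ⟨mul_mem hx hy, fun δ hδ => ?_⟩
    have := δ.leibniz ⟨x, hx⟩ ⟨y, hy⟩
    rwa [hx' δ hδ, hy' δ hδ, smul_zero, smul_zero, add_zero] at this
  inv_mem' := by
    rintro x ⟨hx, hx'⟩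
    refine ⟨inv_mem hx, fun δ hδ => ?_⟩
    have := δ.leibniz_inv ⟨x, hx⟩
    rwa [hx' δ hδ, smul_zero] at this

/-- The rank of a `p`-Lie algebra: its dimension over its base field. -/
noncomputable def PLieAlg.rank (𝓕 : PLieAlg p K) : ℕ := Module.finrank 𝓕.base 𝓕.space

variable (p K) in
/-- A Jacobson sequence on `K`, indexed from `0`: `F 0` is a `p`-Lie algebra on `K`, each
`F (n + 1)` is a `p`-Lie algebra on `Ann (F n)`, and `F (n + 1)` meets
`T_{Ann (F n) / K^{p^(n + 1)}}` only in zero. -/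
structure JacobsonSeq where
  /-- the members of the sequence -/
  F : ℕ → PLieAlg p K
  base_zero : (F 0).base = ⊤
  base_succ : ∀ n, (F (n + 1)).base = (F n).ann
  inf_eq_bot : ∀ n, (F (n + 1)).space ⊓ relTangent (F (n + 1)).base (powField p K (n + 1)) = ⊥

end Tangent

/-! ## Differential operators -/

section Operators

variable {K : Type*} [Field K]

/-- The space `P^{≤ n}_{K/W} = (K ⊗_W K) / J^{n+1}` of principal parts of order at most `n`, where
`J` is the kernel of the multiplication map; it is a `K`-algebra through the first factor. -/
abbrev PrincipalParts (W : Subfield K) (n : ℕ) : Type _ :=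
  (K ⊗[W] K) ⧸ (KaehlerDifferential.ideal W K) ^ (n + 1)

/-- `Diff^{≤ n}_W(K) = Hom_K(P^{≤ n}_{K/W}, K)`, realised as additive operators on `K`: the
functional `φ` gives the operator `x ↦ φ (1 ⊗ x)`. -/
def diffOpsLE (W : Subfield K) (n : ℕ) : Set (AddMonoid.End K) :=
  {T | ∃ φ : PrincipalParts W n →ₗ[K] K,
    ∀ x : K, T x = φ (Ideal.Quotient.mk _ ((1 : K) ⊗ₜ[W] x))}

/-- `Diff_W(K)`: all differential operators on `K` relative to `W`. -/
def diffOps (W : Subfield K) : Set (AddMonoid.End K) := ⋃ n : ℕ, diffOpsLE W n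

/-- The differential `d(K/L)`: it restricts an operator on `K` to an operator from `L` to `K`. -/
def differential (L : Subfield K) (T : AddMonoid.End K) : L →+ K :=
  AddMonoidHom.comp (T : K →+ K) L.subtype.toAddMonoidHom

/-- A derivation of `L`, viewed as an operator from `L` to `K`. -/
def derivToOp (L : Subfield K) (δ : Derivation ℤ L L) : L →+ K :=
  AddMonoidHom.comp L.subtype.toAddMonoidHom (δ : L →ₗ[ℤ] L).toAddMonoidHom

theorem differential_apply (L : Subfield K) (T : AddMonoid.End K) (x : L) :
    differential L T x = T (x : K) := rfl

theorem derivToOp_apply (L : Subfield K) (δ : Derivation ℤ L L) (x : L) :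
    derivToOp L δ x = ((δ x : L) : K) := rfl

end Operators

section Unpacking

variable (p : ℕ) (K : Type*) [Field K] [Fact p.Prime] [CharP K p]

/-- A `K`-subalgebra `K ⊆ 𝓓 ⊆ Diff_k(K)`, where `k = K^{p^∞}`: a ring of operators (under
composition) that contains the multiplications by elements of `K` and consists of differential
operators relative to `k`. -/
structure DiffSubalg where
  /-- the underlying ring of operators -/
  ops : Subring (AddMonoid.End K)
  mulLeft_mem : ∀ a : K, AddMonoid.End.mulLeft a ∈ ops
  le_diffOps : (ops : Set (AddMonoid.End K)) ⊆ diffOps (perfField p K)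

variable {p K}

/-- `d(K/L)(𝓓) ∩ TL`, as a `p`-Lie algebra on `L`: the derivations of `L` that are restrictions to
`L` of operators in `𝓓`. -/
def unpackAt (𝓓 : DiffSubalg p K) (L : Subfield K) : PLieAlg p K where
  base := L
  space :=
    { carrier := {δ | derivToOp L δ ∈ differential L '' (𝓓.ops : Set (AddMonoid.End K))}
      zero_mem' := ⟨0, zero_mem _, rfl⟩
      add_mem' := by
        rintro δ ε ⟨S, hS, hδ⟩ ⟨T, hT, hε⟩
        refine ⟨S + T, add_mem hS hT, ?_⟩
        ext x
        have h1 := DFunLike.congr_fun hδ x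
        have h2 := DFunLike.congr_fun hε x
        rw [differential_apply, derivToOp_apply] at h1 h2
        change S (x : K) + T (x : K) = ((δ x + ε x : L) : K)
        rw [h1, h2]
        rfl
      smul_mem' := by
        rintro c δ ⟨S, hS, hδ⟩
        refine ⟨AddMonoid.End.mulLeft (c : K) * S, mul_mem (𝓓.mulLeft_mem c) hS, ?_⟩
        ext x
        have h1 := DFunLike.congr_fun hδ x
        rw [differential_apply, derivToOp_apply] at h1
        change (c : K) * S (x : K) = ((c * δ x : L) : K)
        rw [h1]
        rfl }
  lie_mem := by
    rintro δ ⟨S, hS, hδ⟩ ε ⟨T, hT, hε⟩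
    refine ⟨S * T - T * S, sub_mem (mul_mem hS hT) (mul_mem hT hS), ?_⟩
    have h1 : ∀ x : L, S (x : K) = ((δ x : L) : K) := fun x => DFunLike.congr_fun hδ x
    have h2 : ∀ x : L, T (x : K) = ((ε x : L) : K) := fun x => DFunLike.congr_fun hε x
    ext x
    rw [differential_apply, derivToOp_apply, Derivation.commutator_apply]
    change S (T (x : K)) - T (S (x : K)) = _
    rw [h1, h2, h1, h2]
    rfl
  pPow_mem := by
    rintro δ ⟨S, hS, hδ⟩
    refine ⟨S ^ p, pow_mem hS p, ?_⟩
    have h1 : ∀ x : L, S (x : K) = ((δ x : L) : K) := fun x => DFunLike.congr_fun hδ x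
    have h2 : ∀ (n : ℕ) (x : L), (S ^ n) (x : K) = (((⇑δ)^[n] x : L) : K) := by
      intro n
      induction n with
      | zero => intro x; rfl
      | succ n ih =>
        intro x
        rw [pow_succ]
        change (S ^ n) (S (x : K)) = _
        rw [h1, ih]
        rfl
    ext x
    rw [differential_apply, derivToOp_apply, pPow_apply, h2]

/-- The fields met in the course of unpacking `𝓓`: the first one is `K`, and each next one is
`Ann (d(K/L)(𝓓) ∩ TL)` for the previous one `L`. -/
def unpackField (𝓓 : DiffSubalg p K) : ℕ → Subfield K
  | 0 => ⊤
  | n + 1 => (unpackAt 𝓓 (unpackField 𝓓 n)).ann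

/-- The unpacking of `𝓓`, indexed from `0`: its `n`-th member is `d(K/L)(𝓓) ∩ TL` where `L` is `K`
for `n = 0`, and the annihilator of the previous member otherwise. -/
def unpack (𝓓 : DiffSubalg p K) (n : ℕ) : PLieAlg p K := unpackAt 𝓓 (unpackField 𝓓 n)

end Unpacking

end DiffCorr

/-!
# Power towers, Jacobson sequences and rings of differential operators

Let `k = ⋂ K^{p^n}` with `K/k` finitely generated. Then `K` is finite over every `K^{p^n}`, so each
level of the three kinds of data lives in a finite purely inseparable extension, where two classical
Galois correspondences apply. Both rest on one device (`exists_dual_points`): a finite-dimensional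
space of functions has a basis `e i` with points `x j` such that `e i (x j) = δ i j`.

*Jacobson's correspondence* (`jacobson`, `exists_derivation_ne_zero`). In a finite-dimensional
`p`-Lie algebra `𝓕` on `L`, a member is determined by its values at the `x j`; hence the dual basis
`D i` commutes and satisfies `D i ^ p = 0`. Taylor expansion in the `x i` then shows that
`L = Ann(𝓕)(x_1, …, x_r)`, with each step of degree `p`. So `[L : Ann 𝓕] = p ^ r`, and a derivation
over `Ann 𝓕` is determined by its values at the `x j`, which gives `T_{L / Ann 𝓕} = 𝓕`. Conversely
`Ann T_{L/M} = M` when `L ^ p ⊆ M`. Applied to `W n ⊇ W (n + 1)`, this is the bijection between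
power towers and Jacobson sequences: the condition `W n = W (n + 1) · K^{p^n}` says that
`T_{W n / W (n + 1)}` and `T_{W n / K^{p^n}}` meet in zero.

*The Jacobson–Bourbaki correspondence* (`linearOps_commutant`, `commutant_linearOps`). A ring of
`E`-linear operators containing `K`, with `K/E` finite, is `End_W(K)` for its commutant `W`. By
`diffOpsLE_subset_linearOps` and `mem_diffOps_of_mem_linearOps`, the differential operators over
`W ⊇ k` are the `W`-linear operators that are linear over some `K^{p^m}`. A ring `𝓓` of differential
operators is therefore the union of its parts `𝓓 ∩ End_{K^{p^n}}(K) = End_{W n}(K)`, and the `W n`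
form a power tower because `End_V ∩ End_W = End_{V · W}`.

Unpacking recovers the tower (`unpackAt_toDiffSubalg`): a derivation of `W n` extends to a
`W m`-linear operator for some `m` exactly when it vanishes on `W (n + 1)`. The ranks do not increase
since `p`-th powers of generators of `W n / W (n + 1)` generate `W (n + 1) / W (n + 2)`.
-/

namespace DiffCorr

/-! ### Dual points of a finite-dimensional space of functions -/

section DualPoints

open Module

/-- Evaluations at points span the dual of a finite-dimensional space of functions, so some points
give a basis of the dual; the `e i` form the basis dual to it. -/
theorem exists_dual_points {X K V : Type*} [Field K] [AddCommGroup V] [Module K V]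
    [FiniteDimensional K V] (ev : V →ₗ[K] X → K) (hev : Function.Injective ev) :
    ∃ (x : Fin (finrank K V) → X) (e : Fin (finrank K V) → V),
      (∀ i j, ev (e i) (x j) = if i = j then 1 else 0) ∧ ∀ v, v = ∑ i, ev v (x i) • e i := by
  classical
  let g : X → Dual K V := fun x => (LinearMap.proj x).comp ev
  obtain ⟨f, hf, hspan, -⟩ := Submodule.exists_fun_fin_finrank_span_eq K (Set.range g)
  choose x hx using hf
  let E : V →ₗ[K] (Fin (finrank K (Submodule.span K (Set.range g))) → K) := LinearMap.pi f
  have hE : Function.Injective E := by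
    rw [← LinearMap.ker_eq_bot, LinearMap.ker_eq_bot']
    intro v hv
    have h1 : Submodule.span K (Set.range f) ≤ LinearMap.ker (Dual.eval K V v) := by
      rw [Submodule.span_le]
      rintro _ ⟨i, rfl⟩
      exact congrFun hv i
    apply hev
    rw [map_zero]
    funext y
    exact h1 (hspan.ge (Submodule.subset_span ⟨y, rfl⟩))
  have hr : finrank K (Submodule.span K (Set.range g)) = finrank K V := by
    apply le_antisymm
    · exact (Submodule.finrank_le _).trans (Subspace.dual_finrank_eq (K := K) (V := V)).le
    · simpa using LinearMap.finrank_le_finrank_of_injective hE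
  rw [← hr]
  let E' := LinearEquiv.ofInjectiveOfFinrankEq E hE (by simp [hr])
  have hE' : ∀ v i, E' v i = ev v (x i) := fun v i =>
    (congrArg (fun φ : Dual K V => φ v) (hx i)).symm
  refine ⟨x, fun i => E'.symm (Pi.single i 1), fun i j => ?_, fun v => ?_⟩
  · rw [← hE', LinearEquiv.apply_symm_apply, Pi.single_apply]
    simp [eq_comm]
  · apply E'.injective
    rw [map_sum]
    funext j
    simp [Finset.sum_apply, Pi.single_apply, hE']

end DualPoints

/-! ### Constants of derivations and Jacobson's theorem -/

section Jacobson

open Module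

variable {L : Type*} [Field L]

/-- The field of constants of a set of derivations of `L`. -/
def constants (S : Set (Derivation ℤ L L)) : Subfield L where
  carrier := {x | ∀ δ ∈ S, δ x = 0}
  zero_mem' := fun δ _ => map_zero δ
  one_mem' := fun δ _ => δ.map_one_eq_zero
  add_mem' := fun hx hy δ hδ => by rw [map_add, hx δ hδ, hy δ hδ, add_zero]
  neg_mem' := fun hx δ hδ => by rw [map_neg, hx δ hδ, neg_zero]
  mul_mem' := fun hx hy δ hδ => by
    rw [δ.leibniz, hx δ hδ, hy δ hδ, smul_zero, smul_zero, add_zero]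
  inv_mem' := fun x hx δ hδ => by rw [δ.leibniz_inv, hx δ hδ, smul_zero]

/-- A derivation vanishing on generators of `L` vanishes. -/
theorem derivation_eq_zero {M : Subfield L} {s : Set L} (h : ⊤ ≤ M ⊔ Subfield.closure s)
    {δ : Derivation ℤ L L} (hM : ∀ x ∈ M, δ x = 0) (hs : ∀ x ∈ s, δ x = 0) : δ = 0 := by
  have h1 : M ⊔ Subfield.closure s ≤ constants {δ} := by
    refine sup_le (fun x hx => ?_) (Subfield.closure_le.2 fun x hx => ?_)
    · rintro _ rfl; exact hM x hx
    · rintro _ rfl; exact hs x hx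
  ext x
  exact h1 (h (Subfield.mem_top x)) δ rfl

theorem derivation_sum_apply {ι : Type*} (s : Finset ι) (f : ι → Derivation ℤ L L) (y : L) :
    (∑ i ∈ s, f i) y = ∑ i ∈ s, f i y := by
  rw [← Derivation.coeFnAddMonoidHom_apply, map_sum, Finset.sum_apply]
  rfl

theorem derivation_pow_char (p : ℕ) [CharP L p] (δ : Derivation ℤ L L) (x : L) : δ (x ^ p) = 0 := by
  rw [Derivation.leibniz_pow, ← Nat.cast_smul_eq_nsmul L, CharP.cast_eq_zero, zero_smul]

variable (p : ℕ) [Fact p.Prime] [CharP L p]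

theorem minpoly_eq_X_pow_sub_C {M : Subfield L} {y : L} (hy : y ∉ M) (hyp : y ^ p ∈ M) :
    minpoly M y = Polynomial.X ^ p - Polynomial.C (⟨y ^ p, hyp⟩ : M) := by
  have hp : p.Prime := Fact.out
  symm
  apply minpoly.eq_of_irreducible_of_monic
  · apply X_pow_sub_C_irreducible_of_prime hp
    intro b hb
    apply hy
    have h1 : (b : L) ^ p = y ^ p := congrArg Subtype.val hb
    have h2 : (b : L) = y := frobenius_inj L p h1
    exact h2 ▸ b.2
  · simp only [map_sub, map_pow, Polynomial.aeval_X, Polynomial.aeval_C]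
    exact sub_self _
  · exact Polynomial.monic_X_pow_sub_C _ hp.ne_zero

theorem isIntegral_of_pow_mem {M : Subfield L} {y : L} {n : ℕ} (hn : n ≠ 0) (hyp : y ^ n ∈ M) :
    IsIntegral M y :=
  IsIntegral.of_pow (Nat.pos_of_ne_zero hn) (isIntegral_algebraMap (x := (⟨y ^ n, hyp⟩ : M)))

theorem finrank_adjoin_eq_char {M : Subfield L} {y : L} (hy : y ∉ M) (hyp : y ^ p ∈ M) :
    finrank M (IntermediateField.adjoin M {y}) = p := by
  rw [IntermediateField.adjoin.finrank (isIntegral_of_pow_mem (Fact.out : p.Prime).ne_zero hyp),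
    minpoly_eq_X_pow_sub_C p hy hyp, Polynomial.natDegree_X_pow_sub_C]

theorem relfinrank_eq_char {M N : Subfield L} (hMN : M ≤ N) {y : L} (hy : y ∉ M)
    (hyp : y ^ p ∈ M) (hyN : y ∈ N) (hN : N ≤ M ⊔ Subfield.closure {y}) :
    M.relfinrank N = p := by
  rw [Subfield.relfinrank_eq_finrank_of_le hMN, ← finrank_adjoin_eq_char p hy hyp]
  suffices h : Subfield.extendScalars hMN = IntermediateField.adjoin M {y} by rw [h]
  apply le_antisymm
  · intro z hz
    have h1 : M ⊔ Subfield.closure {y} ≤ (IntermediateField.adjoin M {y}).toSubfield := by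
      refine sup_le (fun x hx => ?_) (Subfield.closure_le.2 ?_)
      · exact (IntermediateField.adjoin M {y}).algebraMap_mem ⟨x, hx⟩
      · exact IntermediateField.subset_adjoin M {y}
    exact h1 (hN hz)
  · rw [IntermediateField.adjoin_le_iff]
    rintro _ rfl
    exact hyN

section Commuting

variable {ι : Type*} [DecidableEq ι] {D : ι → Derivation ℤ L L} {x : ι → L}

/-- The Taylor expansion in `x i`: the top coefficient `D_i^m y / m!` is a constant, and removing
it lowers the order of vanishing of `y` under iteration of `D_i`. -/
theorem constants_le_sup_closure (hx : ∀ i j, D i (x j) = if i = j then 1 else 0)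
    (hc : ∀ i j y, D i (D j y) = D j (D i y)) (hp : ∀ i y, (D i)^[p] y = 0)
    {S : Finset ι} {i : ι} (hi : i ∉ S) :
    constants (D '' (S : Set ι)) ≤
      constants (D '' (insert i S : Finset ι)) ⊔ Subfield.closure {x i} := by
  set N := constants (D '' (insert i S : Finset ι)) ⊔ Subfield.closure {x i} with hN
  have hxi : x i ∈ N := (le_sup_right : _ ≤ N) (Subfield.subset_closure rfl)
  have hit : ∀ (m : ℕ) (y : L), y ∈ constants (D '' (S : Set ι)) →
      (D i)^[m] y ∈ constants (D '' (S : Set ι)) := by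
    intro m
    induction m with
    | zero => exact fun y hy => hy
    | succ m ih =>
      intro y hy
      rw [Function.iterate_succ_apply]
      apply ih
      rintro _ ⟨j, hj, rfl⟩
      rw [hc, hy _ ⟨j, hj, rfl⟩, map_zero]
  have hconst : ∀ c ∈ constants (D '' (S : Set ι)), D i c = 0 →
      c ∈ constants (D '' (insert i S : Finset ι)) := by
    rintro c hc1 hc2 _ ⟨j, hj, rfl⟩
    rcases Finset.mem_insert.1 hj with rfl | hj
    · exact hc2
    · exact hc1 _ ⟨j, hj, rfl⟩
  have hxS : x i ∈ constants (D '' (S : Set ι)) := by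
    rintro _ ⟨j, hj, rfl⟩
    rw [hx, if_neg]
    rintro rfl
    exact hi hj
  -- iterating a derivation that is linear over the constant `c`
  have hmul : ∀ (c : L), D i c = 0 → ∀ (m : ℕ) (y : L), (D i)^[m] (c * y) = c * (D i)^[m] y := by
    intro c hc m
    induction m with
    | zero => intro y; rfl
    | succ m ih =>
      intro y
      rw [Function.iterate_succ_apply, Function.iterate_succ_apply, Derivation.leibniz, hc,
        smul_zero, add_zero, smul_eq_mul, ih]
  have hpow : ∀ m : ℕ, (D i)^[m] (x i ^ m) = (m.factorial : L) := by
    intro m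
    induction m with
    | zero => simp
    | succ m ih =>
      rw [Function.iterate_succ_apply, Derivation.leibniz_pow, hx, if_pos rfl, Nat.add_sub_cancel,
        smul_eq_mul, mul_one, ← Nat.cast_smul_eq_nsmul L, smul_eq_mul, hmul, ih,
        Nat.factorial_succ, Nat.cast_mul]
      exact Derivation.map_natCast _ _
  have key : ∀ m : ℕ, m ≤ p → ∀ y ∈ constants (D '' (S : Set ι)), (D i)^[m] y = 0 → y ∈ N := by
    intro m
    induction m with
    | zero =>
      intro _ y _ hy
      have : y = 0 := hy
      exact this ▸ zero_mem N
    | succ m ih =>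
      intro hm y hy hy0
      set c := (D i)^[m] y with hcdef
      have hc0 : D i c = 0 := (Function.iterate_succ_apply' _ _ _).symm.trans hy0
      have hfac : (m.factorial : L) ≠ 0 := by
        rw [Ne, CharP.cast_eq_zero_iff L p, (Fact.out : p.Prime).dvd_factorial]
        omega
      set c' := c * (m.factorial : L)⁻¹ with hc'
      have hc'S : c' ∈ constants (D '' (S : Set ι)) :=
        mul_mem (hit m y hy) (inv_mem (natCast_mem _ _))
      have hc'0 : D i c' = 0 := by
        have : c' ∈ constants {D i} := mul_mem (by rintro _ rfl; exact hc0)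
          (inv_mem (natCast_mem _ _))
        exact this _ rfl
      have hc'N : c' ∈ N := (le_sup_left : _ ≤ N) (hconst c' hc'S hc'0)
      have h2 : y - c' * x i ^ m ∈ N := by
        apply ih (by omega) _ (sub_mem hy (mul_mem hc'S (pow_mem hxS m)))
        rw [iterate_map_sub, hmul c' hc'0, hpow, hc', mul_assoc, inv_mul_cancel₀ hfac, mul_one,
          sub_self]
      have h3 := add_mem h2 (mul_mem hc'N (pow_mem hxi m))
      rwa [sub_add_cancel] at h3
  exact fun y hy => key p le_rfl y hy (hp i y)

/-- Commuting derivations `D i` with `D i ^ p = 0` and dual points `x j`: adjoining the `x i`,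
`i ∈ S`, to the common constants one at a time reaches `L`, in steps of degree `p`. -/
theorem top_le_constants_sup_and_relfinrank (hx : ∀ i j, D i (x j) = if i = j then 1 else 0)
    (hc : ∀ i j y, D i (D j y) = D j (D i y)) (hp : ∀ i y, (D i)^[p] y = 0) (S : Finset ι) :
    ⊤ ≤ constants (D '' (S : Set ι)) ⊔ Subfield.closure (Set.range x) ∧
      (constants (D '' (S : Set ι))).relfinrank ⊤ = p ^ S.card := by
  induction S using Finset.induction_on with
  | empty =>
    have : constants (D '' ((∅ : Finset ι) : Set ι)) = ⊤ := by
      rw [eq_top_iff]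
      rintro y - _ ⟨j, hj, rfl⟩
      simp at hj
    rw [this]
    exact ⟨le_sup_left, by simp⟩
  | insert i S hi ih =>
    have hstep := constants_le_sup_closure p hx hc hp hi
    have hle : constants (D '' (insert i S : Finset ι)) ≤ constants (D '' (S : Set ι)) :=
      fun y hy δ ⟨j, hj, h⟩ => hy δ ⟨j, Finset.mem_insert_of_mem hj, h⟩
    constructor
    · refine ih.1.trans (sup_le (hstep.trans ?_) le_sup_right)
      refine sup_le_sup_left (Subfield.closure_mono ?_) _
      rintro _ rfl
      exact ⟨i, rfl⟩
    · rw [← Subfield.relfinrank_mul_relfinrank hle le_top, ih.2, Finset.card_insert_of_notMem hi,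
        pow_succ']
      congr 1
      apply relfinrank_eq_char p hle (y := x i) _ _ _ hstep
      · intro h
        have := h (D i) ⟨i, Finset.mem_insert_self _ _, rfl⟩
        rw [hx, if_pos rfl] at this
        exact one_ne_zero this
      · intro δ _
        exact derivation_pow_char p δ _
      · rintro _ ⟨j, hj, rfl⟩
        rw [hx, if_neg]
        rintro rfl
        exact hi hj

end Commuting

/-- **Jacobson's theorem**. With respect to points `x j` dual to a basis `D i` of the `p`-Lie
algebra, all `[D i, D j]` and all `D i ^ p` vanish, because they lie in the `p`-Lie algebra and kill
every `x j`. Hence `L` is generated over the constants by the `x j`. -/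
theorem jacobson (F : Submodule L (Derivation ℤ L L)) [Module.Finite L F]
    (hlie : ∀ δ ∈ F, ∀ ε ∈ F, ⁅δ, ε⁆ ∈ F) (hpow : ∀ δ ∈ F, pPow p δ ∈ F) :
    (∃ x : Fin (finrank L F) → L, ⊤ ≤ constants F ⊔ Subfield.closure (Set.range x)) ∧
      (constants (F : Set (Derivation ℤ L L))).relfinrank ⊤ = p ^ finrank L F ∧
      ∀ δ : Derivation ℤ L L, (∀ y ∈ constants (F : Set (Derivation ℤ L L)), δ y = 0) → δ ∈ F := by
  let ev : F →ₗ[L] L → L :=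
    { toFun := fun δ y => (δ : Derivation ℤ L L) y
      map_add' := fun _ _ => rfl
      map_smul' := fun _ _ => rfl }
  have hev : Function.Injective ev := fun a b h => Subtype.ext (Derivation.ext fun y => congrFun h y)
  obtain ⟨x, e, hx, hv⟩ := exists_dual_points ev hev
  let D : Fin (finrank L F) → Derivation ℤ L L := fun i => e i
  have hD : ∀ i j, D i (x j) = if i = j then 1 else 0 := hx
  have hzero : ∀ δ ∈ F, (∀ j, δ (x j) = 0) → δ = 0 := by
    intro δ hδ h
    have h1 := hv ⟨δ, hδ⟩
    have h2 : ∀ j, ev ⟨δ, hδ⟩ (x j) = 0 := h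
    simp only [h2, zero_smul, Finset.sum_const_zero] at h1
    exact congrArg Subtype.val h1
  have hcst : ∀ i j k, D i (D j (x k)) = 0 := by
    intro i j k
    rw [hD]
    split_ifs
    · exact Derivation.map_one_eq_zero _
    · exact map_zero _
  have hc : ∀ i j y, D i (D j y) = D j (D i y) := by
    intro i j y
    have h := hzero ⁅D i, D j⁆ (hlie _ (e i).2 _ (e j).2) fun k => by
      rw [Derivation.commutator_apply, hcst, hcst, sub_zero]
    have h2 := congrArg (fun δ : Derivation ℤ L L => δ y) h
    exact sub_eq_zero.1 ((Derivation.commutator_apply (D1 := D i) (D2 := D j) y).symm.trans h2)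
  have hp : ∀ i y, (D i)^[p] y = 0 := by
    intro i y
    have h := hzero (pPow p (D i)) (hpow _ (e i).2) fun k => by
      obtain ⟨n, hn⟩ := Nat.exists_eq_add_of_le' (Fact.out : p.Prime).two_le
      rw [pPow_apply, show (D i)^[p] (x k) = (D i)^[n + 2] (x k) by rw [← hn],
        Function.iterate_add_apply]
      change (D i)^[n] (D i (D i (x k))) = 0
      rw [hcst]
      exact Function.iterate_fixed (map_zero _) n
    rw [← pPow_apply, h]
    rfl
  have hF : constants (D '' (Finset.univ : Finset (Fin (finrank L F)))) = constants F := by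
    apply le_antisymm
    · intro y hy δ hδ
      have h1 := congrArg Subtype.val (hv ⟨δ, hδ⟩)
      rw [AddSubmonoidClass.coe_finsetSum] at h1
      have h2 := congrArg (fun ε : Derivation ℤ L L => ε y) h1
      simp only [derivation_sum_apply] at h2
      rw [h2]
      refine Finset.sum_eq_zero fun i _ => ?_
      have h3 : D i y = 0 := hy _ ⟨i, Finset.mem_coe.2 (Finset.mem_univ i), rfl⟩
      change ev ⟨δ, hδ⟩ (x i) • D i y = 0
      rw [h3, smul_zero]
    · rintro y hy _ ⟨i, -, rfl⟩
      exact hy _ (e i).2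
  have main := top_le_constants_sup_and_relfinrank p hD hc hp Finset.univ
  rw [hF, Finset.card_univ, Fintype.card_fin] at main
  refine ⟨⟨x, main.1⟩, main.2, fun δ hδ => ?_⟩
  have hsum : (∑ i, δ (x i) • D i) ∈ F :=
    F.sum_mem fun i _ => F.smul_mem _ (e i).2
  have h0 : δ - ∑ i, δ (x i) • D i = 0 := by
    apply derivation_eq_zero main.1
    · intro y hy
      rw [Derivation.sub_apply, hδ y hy, hy _ hsum, sub_zero]
    · rintro _ ⟨k, rfl⟩
      rw [Derivation.sub_apply, derivation_sum_apply]
      simp [hD]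
  rw [sub_eq_zero.1 h0]
  exact hsum

end Jacobson

/-! ### Existence of derivations -/

section Existence

open Module Polynomial

variable {L : Type*} [Field L]

/-- Derivations over `M` embed into functions on a set of generators of `L` over `M`. -/
theorem finite_and_finrank_le_card {M : Subfield L} {ι : Type*} [Fintype ι] {x : ι → L}
    (h : ⊤ ≤ M ⊔ Subfield.closure (Set.range x)) (F : Submodule L (Derivation ℤ L L))
    (hF : ∀ δ ∈ F, ∀ y ∈ M, δ y = 0) : Module.Finite L F ∧ finrank L F ≤ Fintype.card ι := by
  let ev : F →ₗ[L] ι → L :=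
    { toFun := fun δ i => (δ : Derivation ℤ L L) (x i)
      map_add' := fun _ _ => rfl
      map_smul' := fun _ _ => rfl }
  have hev : Function.Injective ev := by
    rw [← LinearMap.ker_eq_bot, LinearMap.ker_eq_bot']
    rintro ⟨δ, hδ⟩ h0
    apply Subtype.ext
    apply derivation_eq_zero h (hF δ hδ)
    rintro _ ⟨i, rfl⟩
    exact congrFun h0 i
  exact ⟨Module.Finite.of_injective ev hev,
    (LinearMap.finrank_le_finrank_of_injective hev).trans (finrank_fintype_fun_eq_card L).le⟩

variable (p : ℕ) [Fact p.Prime] [CharP L p]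

/-- If `L = M(x)` with `x ∉ M` and `x ^ p ∈ M`, then `d/dx` is a derivation of `L`. -/
theorem exists_derivation_eq_one {M : Subfield L} {x : L} (hx : x ∉ M) (hxp : x ^ p ∈ M)
    (htop : IntermediateField.adjoin M {x} = ⊤) :
    ∃ δ : Derivation ℤ L L, (∀ y ∈ M, δ y = 0) ∧ δ x = 1 := by
  have hint : IsIntegral M x := isIntegral_of_pow_mem (Fact.out : p.Prime).ne_zero hxp
  have hsurj : Function.Surjective (aeval x : M[X] →ₐ[M] L) := by
    rw [← AlgHom.range_eq_top, ← Algebra.adjoin_singleton_eq_range_aeval,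
      ← IntermediateField.adjoin_simple_toSubalgebra_of_isAlgebraic hint.isAlgebraic, htop,
      IntermediateField.top_toSubalgebra]
  have hd : ∀ q : M[X], aeval x q = 0 → aeval x (derivative' q) = 0 := by
    intro q hq
    obtain ⟨r, rfl⟩ := minpoly.dvd M x hq
    have h0 := minpoly.aeval M x
    rw [minpoly_eq_X_pow_sub_C p hx hxp] at h0 ⊢
    simp [h0, derivative_X_pow]
  refine ⟨(Derivation.liftOfSurjective hsurj hd).restrictScalars ℤ, fun y hy => ?_, ?_⟩
  · exact Derivation.map_algebraMap (Derivation.liftOfSurjective hsurj hd) (⟨y, hy⟩ : M)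
  · have h := Derivation.liftOfSurjective_apply hsurj hd X
    rw [aeval_X] at h
    change Derivation.liftOfSurjective hsurj hd x = 1
    rw [h]
    simp

/-- If `L ^ p ⊆ M`, then the elements of `M` are the only ones killed by all derivations of `L` over
`M`: a subfield `N ⊇ M` maximal among those not containing `x` satisfies `L = N(x)`. -/
theorem exists_derivation_ne_zero {M : Subfield L} (hM : ∀ x : L, x ^ p ∈ M) {x : L}
    (hx : x ∉ M) : ∃ δ : Derivation ℤ L L, (∀ y ∈ M, δ y = 0) ∧ δ x ≠ 0 := by
  obtain ⟨N, hMN, hxN, hmax⟩ := zorn_le_nonempty₀ {N : Subfield L | x ∉ N} (by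
    intro c hc hchain N hN
    refine ⟨sSup c, fun h => ?_, fun z hz => le_sSup hz⟩
    obtain ⟨N', hN', hx'⟩ := (Subfield.mem_sSup_of_directedOn ⟨N, hN⟩ hchain.directedOn).1 h
    exact hc hN' hx') M hx
  have hp0 : p ≠ 0 := (Fact.out : p.Prime).ne_zero
  have htop : IntermediateField.adjoin N {x} = ⊤ := by
    rw [eq_top_iff]
    intro y _
    by_cases hy : y ∈ N
    · exact (IntermediateField.adjoin N {x}).algebraMap_mem ⟨y, hy⟩
    have hyA : y ∈ IntermediateField.adjoin N {y} := IntermediateField.mem_adjoin_simple_self N y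
    have hxA : x ∈ IntermediateField.adjoin N {y} := by
      by_contra h
      have h1 : N ≤ (IntermediateField.adjoin N {y}).toSubfield := fun z hz =>
        (IntermediateField.adjoin N {y}).algebraMap_mem ⟨z, hz⟩
      exact hy (hmax (y := (IntermediateField.adjoin N {y}).toSubfield) h h1 hyA)
    have hfin : FiniteDimensional N (IntermediateField.adjoin N {y}) :=
      IntermediateField.adjoin.finiteDimensional (isIntegral_of_pow_mem hp0 (hMN (hM y)))
    have heq := IntermediateField.eq_of_le_of_finrank_eq
      (IntermediateField.adjoin_simple_le_iff.2 hxA)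
      ((finrank_adjoin_eq_char p hxN (hMN (hM x))).trans
        (finrank_adjoin_eq_char p hy (hMN (hM y))).symm)
    rw [heq]
    exact hyA
  obtain ⟨δ, h1, h2⟩ := exists_derivation_eq_one p hxN (hMN (hM x)) htop
  exact ⟨δ, fun y hy => h1 y (hMN hy), by rw [h2]; exact one_ne_zero⟩

end Existence

/-! ### Subfields of `p`-powers -/

section Powers

open Module

variable {p : ℕ} {K : Type*} [Field K] [Fact p.Prime] [CharP K p]

theorem mem_powField {n : ℕ} {x : K} : x ∈ powField p K n ↔ ∃ y, y ^ p ^ n = x := by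
  simp [powField, RingHom.mem_fieldRange, iterateFrobenius_def]

theorem pow_mem_powField (n : ℕ) (x : K) : x ^ p ^ n ∈ powField p K n := mem_powField.2 ⟨x, rfl⟩

theorem powField_zero : powField p K 0 = ⊤ := by
  rw [eq_top_iff]
  exact fun x _ => mem_powField.2 ⟨x, by simp⟩

theorem powField_antitone : Antitone (powField p K) := by
  intro m n hmn x hx
  obtain ⟨y, rfl⟩ := mem_powField.1 hx
  obtain ⟨d, rfl⟩ := Nat.exists_eq_add_of_le hmn
  exact mem_powField.2 ⟨y ^ p ^ d, by rw [← pow_mul, pow_add, mul_comm]⟩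

theorem perfField_le_powField (n : ℕ) : perfField p K ≤ powField p K n := iInf_le _ n

theorem finiteDimensional_of_powField_le (hK : (⊤ : IntermediateField (perfField p K) K).FG)
    {W : Subfield K} {n : ℕ} (hW : powField p K n ≤ W) : FiniteDimensional W K := by
  obtain ⟨s, hs⟩ := hK
  have hfin : FiniteDimensional W (IntermediateField.adjoin W (s : Set K)) :=
    IntermediateField.finiteDimensional_adjoin fun x _ =>
      isIntegral_of_pow_mem (pow_ne_zero n (Fact.out : p.Prime).ne_zero)
        (hW (pow_mem_powField n x))
  have htop : IntermediateField.adjoin W (s : Set K) = ⊤ := by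
    rw [eq_top_iff]
    intro x _
    have hx : x ∈ IntermediateField.adjoin (perfField p K) (s : Set K) := hs ▸ trivial
    have hle : (IntermediateField.adjoin (perfField p K) (s : Set K)).toSubfield ≤
        (IntermediateField.adjoin W (s : Set K)).toSubfield := by
      rw [IntermediateField.adjoin_toSubfield, Subfield.closure_le]
      rintro y (⟨z, rfl⟩ | hy)
      · exact (IntermediateField.adjoin W (s : Set K)).algebraMap_mem
          ⟨z, hW (perfField_le_powField n z.2)⟩
      · exact IntermediateField.subset_adjoin _ _ hy
    exact hle hx
  rw [htop] at hfin
  exact Module.Finite.equiv (IntermediateField.topEquiv (F := W) (E := K)).toLinearEquiv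

theorem essFiniteType_of_perfField_le (hK : (⊤ : IntermediateField (perfField p K) K).FG)
    {W : Subfield K} (hW : perfField p K ≤ W) : Algebra.EssFiniteType W K := by
  rw [IntermediateField.fg_top_iff] at hK
  let _ : Algebra (perfField p K) W := (Subfield.inclusion hW).toAlgebra
  have : IsScalarTower (perfField p K) W K := IsScalarTower.of_algebraMap_eq fun _ => rfl
  exact Algebra.EssFiniteType.of_comp (perfField p K) W K

end Powers

/-! ### The Galois correspondence of Jacobson for subfields of `K` -/

section Correspondence

open Module

variable {p : ℕ} {K : Type*} [Field K] [Fact p.Prime] [CharP K p]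

/-- The Galois correspondence in the direction `M ↦ T_{L/M} ↦ Ann T_{L/M}`. -/
theorem ann_relTangentAlg {L M : Subfield K} (hML : M ≤ L) (hp : ∀ x ∈ L, x ^ p ∈ M) :
    (relTangentAlg p L M).ann = M := by
  apply le_antisymm
  · rintro x ⟨hx, h⟩
    by_contra hxM
    obtain ⟨δ, h1, h2⟩ := exists_derivation_ne_zero p (M := M.comap L.subtype)
      (fun y : L => hp y y.2) (x := ⟨x, hx⟩) hxM
    exact h2 (h δ h1)
  · exact fun x hx => ⟨hML hx, fun δ hδ => hδ _ hx⟩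

/-- Derivations of a field `L ⊇ K^{p^n}` vanish on `L ^ p ⊇ K^{p^(n + 1)}`, over which `L` is
finite. -/
theorem finite_space (hK : (⊤ : IntermediateField (perfField p K) K).FG) {n : ℕ}
    (𝓕 : PLieAlg p K) (h : powField p K n ≤ 𝓕.base) : Module.Finite 𝓕.base 𝓕.space := by
  set E := powField p K (n + 1)
  have hE : E ≤ 𝓕.base := (powField_antitone n.le_succ).trans h
  have hEK : FiniteDimensional E K := finiteDimensional_of_powField_le hK le_rfl
  have hpos : 0 < finrank (E.comap 𝓕.base.subtype) 𝓕.base := by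
    rw [Subfield.finrank_comap, 𝓕.base.fieldRange_subtype]
    have h1 : 0 < finrank E K := finrank_pos
    rw [← Subfield.relfinrank_mul_finrank_top hE] at h1
    exact Nat.pos_of_mul_pos_right h1
  have hfin : FiniteDimensional (E.comap 𝓕.base.subtype) 𝓕.base := Module.finite_of_finrank_pos hpos
  let b := finBasis (E.comap 𝓕.base.subtype) 𝓕.base
  refine (finite_and_finrank_le_card (M := E.comap 𝓕.base.subtype) (x := b) ?_ 𝓕.space ?_).1
  · intro x _
    rw [← b.sum_repr x]
    refine sum_mem fun i _ => mul_mem ?_ ?_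
    · exact (le_sup_left : _ ≤ E.comap 𝓕.base.subtype ⊔ _) (b.repr x i).2
    · exact (le_sup_right : Subfield.closure (Set.range b) ≤ _)
        (Subfield.subset_closure ⟨i, rfl⟩)
  · intro δ _ y hy
    obtain ⟨z, hz⟩ := mem_powField.1 hy
    have hzL : z ^ p ^ n ∈ 𝓕.base := h (pow_mem_powField n z)
    have : y = (⟨z ^ p ^ n, hzL⟩ : 𝓕.base) ^ p := by
      apply Subtype.ext
      change (y : K) = (z ^ p ^ n) ^ p
      rw [← pow_mul, ← pow_succ]
      exact hz.symm
    rw [this]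
    exact derivation_pow_char p δ _

theorem constants_space (𝓕 : PLieAlg p K) :
    constants (𝓕.space : Set (Derivation ℤ 𝓕.base 𝓕.base)) = 𝓕.ann.comap 𝓕.base.subtype := by
  ext x
  exact ⟨fun h => ⟨x.2, h⟩, fun ⟨_, h⟩ => h⟩

theorem ann_le_base (𝓕 : PLieAlg p K) : 𝓕.ann ≤ 𝓕.base := fun _ ⟨h, _⟩ => h

theorem pow_mem_ann (𝓕 : PLieAlg p K) {x : K} (hx : x ∈ 𝓕.base) : x ^ p ∈ 𝓕.ann :=
  ⟨pow_mem hx p, fun δ _ => derivation_pow_char p δ ⟨x, hx⟩⟩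

/-- The Galois correspondence in the direction `𝓕 ↦ Ann 𝓕 ↦ T_{L / Ann 𝓕}`. -/
theorem relTangent_ann (𝓕 : PLieAlg p K) [Module.Finite 𝓕.base 𝓕.space] :
    relTangent 𝓕.base 𝓕.ann = 𝓕.space := by
  have h := (jacobson p 𝓕.space 𝓕.lie_mem 𝓕.pPow_mem).2.2
  ext δ
  constructor
  · intro hδ
    exact h δ fun y hy => hδ y ⟨y.2, hy⟩
  · rintro hδ x ⟨hx, hx'⟩
    exact hx' δ hδ

theorem PLieAlg.mk_eq_mk {L : Subfield K} {s t : Submodule L (Derivation ℤ L L)} (h : s = t)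
    {h₁ h₂ h₃ h₄} : (⟨L, s, h₁, h₂⟩ : PLieAlg p K) = ⟨L, t, h₃, h₄⟩ := by
  subst h
  rfl

theorem relTangentAlg_ann (𝓕 : PLieAlg p K) [Module.Finite 𝓕.base 𝓕.space] :
    relTangentAlg p 𝓕.base 𝓕.ann = 𝓕 :=
  PLieAlg.mk_eq_mk (relTangent_ann 𝓕)

theorem pow_rank_eq_relfinrank (𝓕 : PLieAlg p K) [Module.Finite 𝓕.base 𝓕.space] :
    p ^ 𝓕.rank = 𝓕.ann.relfinrank 𝓕.base := by
  have h := (jacobson p 𝓕.space 𝓕.lie_mem 𝓕.pPow_mem).2.1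
  rw [PLieAlg.rank, ← h, constants_space, Subfield.relfinrank_top_right, Subfield.finrank_comap,
    𝓕.base.fieldRange_subtype]

theorem exists_generators (𝓕 : PLieAlg p K) [Module.Finite 𝓕.base 𝓕.space] :
    ∃ x : Fin 𝓕.rank → K, (∀ i, x i ∈ 𝓕.base) ∧
      𝓕.base ≤ 𝓕.ann ⊔ Subfield.closure (Set.range x) := by
  obtain ⟨x, hx⟩ := (jacobson p 𝓕.space 𝓕.lie_mem 𝓕.pPow_mem).1
  refine ⟨fun i => x i, fun i => (x i).2, fun y hy => ?_⟩
  have hle : constants (𝓕.space : Set (Derivation ℤ 𝓕.base 𝓕.base)) ⊔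
      Subfield.closure (Set.range x) ≤
        (𝓕.ann ⊔ Subfield.closure (Set.range fun i => (x i : K))).comap 𝓕.base.subtype := by
    rw [constants_space]
    refine sup_le (fun z hz => (le_sup_left : 𝓕.ann ≤ _) hz) (Subfield.closure_le.2 ?_)
    rintro _ ⟨i, rfl⟩
    exact (le_sup_right : Subfield.closure (Set.range fun i => (x i : K)) ≤ _)
      (Subfield.subset_closure ⟨i, rfl⟩)
  exact hle (hx (Subfield.mem_top ⟨y, hy⟩))

end Correspondence

/-! ### Operators that are linear over a subfield -/

section LinearOps

open Module

variable {K : Type*} [Field K]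

/-- The ring `End_W(K)` of `W`-linear operators on `K`. -/
def linearOps (W : Subfield K) : Subring (AddMonoid.End K) where
  carrier := {T | ∀ w ∈ W, ∀ x : K, T (w * x) = w * T x}
  zero_mem' := fun w _ _ => (mul_zero w).symm
  one_mem' := fun _ _ _ => rfl
  add_mem' := fun {S T} hS hT w hw x => by
    change S (w * x) + T (w * x) = w * (S x + T x)
    rw [hS w hw, hT w hw, mul_add]
  neg_mem' := fun {S} hS w hw x => by
    change -S (w * x) = w * -S x
    rw [hS w hw, mul_neg]
  mul_mem' := fun {S T} hS hT w hw x => by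
    change S (T (w * x)) = w * S (T x)
    rw [hT w hw, hS w hw]

theorem mulLeft_mem_linearOps (W : Subfield K) (a : K) :
    AddMonoid.End.mulLeft a ∈ linearOps W := fun w _ x => mul_left_comm a w x

theorem linearOps_antitone : Antitone (linearOps (K := K)) :=
  fun _ _ h _ hT w hw => hT w (h hw)

/-- The elements of `K` that commute with all operators in a ring `R` of operators. -/
def commutant (R : Subring (AddMonoid.End K)) : Subfield K where
  carrier := {w | ∀ T ∈ R, ∀ x : K, T (w * x) = w * T x}
  zero_mem' := fun T _ x => by rw [zero_mul, map_zero, zero_mul]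
  one_mem' := fun T _ x => by rw [one_mul, one_mul]
  add_mem' := fun ha hb T hT x => by rw [add_mul, map_add, ha T hT, hb T hT, add_mul]
  neg_mem' := fun ha T hT x => by rw [neg_mul, map_neg, ha T hT, neg_mul]
  mul_mem' := fun ha hb T hT x => by rw [mul_assoc, ha T hT, hb T hT, mul_assoc]
  inv_mem' := fun a ha T hT x => by
    rcases eq_or_ne a 0 with rfl | h0
    · rw [inv_zero, zero_mul, map_zero, zero_mul]
    · have h := ha T hT (a⁻¹ * x)
      rw [mul_inv_cancel_left₀ h0] at h
      rw [h, inv_mul_cancel_left₀ h0]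

theorem le_commutant_iff {R : Subring (AddMonoid.End K)} {W : Subfield K} :
    W ≤ commutant R ↔ R ≤ linearOps W :=
  ⟨fun h _ hT _ hw => h hw _ hT, fun h _ hw _ hT => h hT _ hw⟩

theorem linearOps_sup (V W : Subfield K) : linearOps (V ⊔ W) = linearOps V ⊓ linearOps W := by
  apply le_antisymm
  · exact le_inf (linearOps_antitone le_sup_left) (linearOps_antitone le_sup_right)
  · rw [← le_commutant_iff]
    exact sup_le (le_commutant_iff.2 inf_le_left) (le_commutant_iff.2 inf_le_right)

theorem exists_linearOps_extend (W : Subfield K) (V : Submodule W K) (f : V →ₗ[W] K) :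
    ∃ T ∈ linearOps W, ∀ x : V, T (x : K) = f x := by
  obtain ⟨g, hg⟩ := f.exists_extend
  exact ⟨g.toAddMonoidHom, fun w hw x => g.map_smul (⟨w, hw⟩ : W) x,
    fun x => DFunLike.congr_fun hg x⟩

theorem commutant_linearOps (W : Subfield K) : commutant (linearOps W) = W := by
  apply le_antisymm
  · intro x hx
    by_contra hxW
    -- the functional that kills `W` separates `x` from `W`
    obtain ⟨f, hf, hfW⟩ := Submodule.exists_le_ker_of_notMem
      (p := LinearMap.range (Algebra.linearMap W K)) (v := x)
      (by rintro ⟨w, hw⟩; exact hxW (hw ▸ w.2))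
    obtain ⟨T, hT, hTf⟩ := exists_linearOps_extend W ⊤
      (((Algebra.linearMap W K).comp f).comp (Submodule.subtype ⊤))
    have hTf' : ∀ y : K, T y = (f y : K) := fun y => hTf ⟨y, trivial⟩
    have h1 := hx T hT 1
    have h2 : f 1 = 0 := hfW ⟨1, rfl⟩
    rw [mul_one, hTf', hTf', h2] at h1
    apply hf
    apply Subtype.ext
    simpa using h1
  · exact le_commutant_iff.2 le_rfl

theorem linearOps_injective : Function.Injective (linearOps (K := K)) := fun V W h => by
  rw [← commutant_linearOps V, h, commutant_linearOps]

/-- **The Jacobson–Bourbaki theorem**: a ring of operators that contains the multiplications and is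
linear over a subfield of finite index is the ring of all operators linear over its commutant.
With respect to points `x j` dual to a `K`-basis `S i` of the ring, the values of the `S i` lie in
the commutant, since `T ∘ z ∘ S i` and `T z • S i` agree at all `x j`. -/
theorem linearOps_commutant {E : Subfield K} [FiniteDimensional E K]
    (R : Subring (AddMonoid.End K)) (hmul : ∀ a, AddMonoid.End.mulLeft a ∈ R)
    (hRE : R ≤ linearOps E) : linearOps (commutant R) = R := by
  apply le_antisymm _ (le_commutant_iff.1 le_rfl)
  intro T hT
  let V : Submodule K (K → K) :=
    { carrier := {f | ∃ S ∈ R, ⇑S = f}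
      zero_mem' := ⟨0, zero_mem R, rfl⟩
      add_mem' := by
        rintro _ _ ⟨S, hS, rfl⟩ ⟨T, hT, rfl⟩
        exact ⟨S + T, add_mem hS hT, rfl⟩
      smul_mem' := by
        rintro c _ ⟨S, hS, rfl⟩
        exact ⟨AddMonoid.End.mulLeft c * S, mul_mem (hmul c) hS, rfl⟩ }
  have hfin : FiniteDimensional K V := by
    let b := finBasis E K
    let r : V →ₗ[K] (Fin (finrank E K) → K) := (LinearMap.funLeft K K b).comp V.subtype
    refine Module.Finite.of_injective r ?_
    rw [← LinearMap.ker_eq_bot, LinearMap.ker_eq_bot']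
    rintro ⟨_, S, hS, rfl⟩ h0
    apply Subtype.ext
    funext y
    change S y = 0
    rw [← b.sum_repr y, map_sum]
    refine Finset.sum_eq_zero fun i _ => ?_
    have h1 : S (b i) = 0 := congrFun h0 i
    have h2 := hRE hS _ (b.repr y i).2 (b i)
    rw [h1, mul_zero] at h2
    exact h2
  obtain ⟨x, e, hx, hv⟩ := exists_dual_points V.subtype V.subtype_injective
  choose S hSR hSe using fun i => (e i).2
  have hS : ∀ i j, S i (x j) = if i = j then 1 else 0 := fun i j => by
    rw [← hx i j, hSe]
    rfl
  have hexp : ∀ U ∈ R, ∀ y, U y = ∑ j, U (x j) * S j y := by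
    intro U hU y
    have h1 := congrFun (congrArg Subtype.val (hv ⟨U, U, hU, rfl⟩)) y
    rw [AddSubmonoidClass.coe_finsetSum, Finset.sum_apply] at h1
    refine h1.trans (Finset.sum_congr rfl fun j _ => ?_)
    rw [hSe]
    rfl
  have hcomm : ∀ i y, S i y ∈ commutant R := by
    intro i y U hU z
    have h1 := hexp (U * AddMonoid.End.mulLeft z * S i)
      (mul_mem (mul_mem hU (hmul z)) (hSR i)) y
    have h2 : ∀ w, (U * AddMonoid.End.mulLeft z * S i) w = U (z * S i w) := fun _ => rfl
    simp only [h2, hS] at h1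
    rw [Finset.sum_eq_single i (fun j _ hj => by simp [hj.symm]) (by simp)] at h1
    rw [mul_comm (S i y) z, h1, if_pos rfl, mul_one, mul_comm]
  have hTS : T = ∑ j, AddMonoid.End.mulLeft (T (x j)) * S j := by
    ext y
    have h1 : y = ∑ j, S j y * x j := by
      simpa [mul_comm] using hexp 1 (one_mem R) y
    have h2 : (∑ j, AddMonoid.End.mulLeft (T (x j)) * S j) y = ∑ j, T (x j) * S j y := by
      exact map_sum (AddMonoidHom.eval y) (fun j => AddMonoid.End.mulLeft (T (x j)) * S j) _
    rw [h2]
    nth_rewrite 1 [h1]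
    rw [map_sum]
    refine Finset.sum_congr rfl fun j _ => ?_
    rw [hT _ (hcomm j y), mul_comm]
  rw [hTS]
  exact sum_mem fun j _ => mul_mem (hmul _) (hSR j)

end LinearOps

/-! ### Differential operators -/

section DiffOps

open KaehlerDifferential

variable {K : Type*} [Field K]

theorem diffOps_subset_linearOps (W : Subfield K) : diffOps W ⊆ linearOps W := by
  intro T hT w hw x
  obtain ⟨n, φ, hφ⟩ := Set.mem_iUnion.1 hT
  have h : (1 : K) ⊗ₜ[W] (w * x) = w • ((1 : K) ⊗ₜ[W] x) := by
    have h1 := TensorProduct.smul_tmul (R := W) (⟨w, hw⟩ : W) (1 : K) x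
    rw [TensorProduct.smul_tmul']
    exact h1.symm
  rw [hφ, hφ, h]
  exact φ.map_smul w (Ideal.Quotient.mk _ ((1 : K) ⊗ₜ[W] x))

variable (p : ℕ) [Fact p.Prime] [CharP K p]

theorem tmul_sub_tmul_pow (W : Subfield K) (x : K) (n : ℕ) :
    ((1 : K) ⊗ₜ[W] x - x ⊗ₜ[W] (1 : K)) ^ p ^ n =
      (1 : K) ⊗ₜ[W] (x ^ p ^ n) - (x ^ p ^ n) ⊗ₜ[W] (1 : K) := by
  have : CharP (K ⊗[W] K) p :=
    charP_of_injective_algebraMap (algebraMap K (K ⊗[W] K)).injective p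
  rw [sub_pow_char_pow, Algebra.TensorProduct.tmul_pow, Algebra.TensorProduct.tmul_pow]
  simp only [one_pow]

/-- An operator of order at most `n` is linear over `K^{p^n}`: modulo `J ^ (n + 1)` the two copies
of `x ^ p ^ n` in `K ⊗ K` agree. -/
theorem diffOpsLE_subset_linearOps (W : Subfield K) (n : ℕ) :
    diffOpsLE W n ⊆ linearOps (powField p K n) := by
  rintro T ⟨φ, hφ⟩ w hw y
  obtain ⟨x, rfl⟩ := mem_powField.1 hw
  have h : (1 : K) ⊗ₜ[W] (x ^ p ^ n) - (x ^ p ^ n) ⊗ₜ[W] (1 : K) ∈ ideal W K ^ (n + 1) := by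
    rw [← tmul_sub_tmul_pow]
    exact Ideal.pow_le_pow_right (Nat.lt_pow_self (Fact.out : p.Prime).one_lt)
      (Ideal.pow_mem_pow (one_smul_sub_smul_one_mem_ideal W x) _)
  have h2 : Ideal.Quotient.mk (ideal W K ^ (n + 1)) ((1 : K) ⊗ₜ[W] (x ^ p ^ n * y)) =
      Ideal.Quotient.mk (ideal W K ^ (n + 1)) ((x ^ p ^ n) • ((1 : K) ⊗ₜ[W] y)) := by
    rw [Ideal.Quotient.eq]
    convert Ideal.mul_mem_right ((1 : K) ⊗ₜ[W] y) _ h using 1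
    rw [sub_mul, Algebra.TensorProduct.tmul_mul_tmul, Algebra.TensorProduct.tmul_mul_tmul, one_mul,
      one_mul, mul_one, TensorProduct.smul_tmul', smul_eq_mul, mul_one]
  rw [hφ, hφ, h2]
  exact φ.map_smul (x ^ p ^ n) (Ideal.Quotient.mk _ ((1 : K) ⊗ₜ[W] y))

/-- Since `K` is essentially of finite type over `W`, the ideal `J` is finitely generated, so a
power of it lies in the ideal generated by the `1 ⊗ x ^ p ^ m - x ^ p ^ m ⊗ 1`, which are killed by
the functional of a `K^{p^m}`-linear operator. -/
theorem mem_diffOps_of_mem_linearOps {W : Subfield K} [Algebra.EssFiniteType W K]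
    {T : AddMonoid.End K} (hW : T ∈ linearOps W) {m : ℕ} (hm : T ∈ linearOps (powField p K m)) :
    T ∈ diffOps W := by
  let T' : K →ₗ[W] K :=
    { toFun := T
      map_add' := map_add T
      map_smul' := fun w x => hW w w.2 x }
  let Φ : K ⊗[W] K →ₗ[K] K := LinearMap.liftBaseChange K T'
  have hΦ : ∀ a x : K, Φ (a ⊗ₜ x) = a * T x := fun a x => LinearMap.liftBaseChange_tmul K T' a x
  let g : K → K ⊗[W] K := fun x => (1 : K) ⊗ₜ[W] (x ^ p ^ m) - (x ^ p ^ m) ⊗ₜ[W] (1 : K)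
  have hg : ∀ (s : K ⊗[W] K) (x : K), Φ (s * g x) = 0 := by
    intro s x
    induction s using TensorProduct.induction_on with
    | zero => rw [zero_mul, map_zero]
    | tmul a y =>
      have h1 := hm _ (pow_mem_powField m x) y
      rw [mul_sub, Algebra.TensorProduct.tmul_mul_tmul, Algebra.TensorProduct.tmul_mul_tmul,
        map_sub, hΦ, hΦ, mul_one, mul_one, mul_comm y, h1, mul_assoc, sub_self]
    | add s t hs ht => rw [add_mul, map_add, hs, ht, add_zero]
  have hI : ∀ t ∈ Ideal.span (Set.range g), ∀ s, Φ (s * t) = 0 := by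
    intro t ht
    induction ht using Submodule.span_induction with
    | mem t ht =>
      obtain ⟨x, rfl⟩ := ht
      exact fun s => hg s x
    | zero => exact fun s => by rw [mul_zero, map_zero]
    | add u t _ _ hu ht => exact fun s => by rw [mul_add, map_add, hu, ht, add_zero]
    | smul r t _ ht => exact fun s => by rw [smul_eq_mul, ← mul_assoc]; exact ht _
  have hrad : ideal W K ≤ (Ideal.span (Set.range g)).radical := by
    rw [← span_range_eq_ideal, Ideal.span_le]
    rintro _ ⟨x, rfl⟩
    refine ⟨p ^ m, ?_⟩
    dsimp only
    rw [tmul_sub_tmul_pow]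
    exact Ideal.subset_span ⟨x, rfl⟩
  obtain ⟨N, hN⟩ := Ideal.exists_pow_le_of_le_radical_of_fg hrad (ideal_fg W K)
  have hker : (ideal W K ^ (N + 1)).restrictScalars K ≤ LinearMap.ker Φ := fun t ht => by
    have h := hI t (hN (Ideal.pow_le_pow_right N.le_succ ht)) 1
    rwa [one_mul] at h
  refine Set.mem_iUnion.2 ⟨N, (Submodule.liftQ _ Φ hker).comp
    (Submodule.Quotient.restrictScalarsEquiv K (ideal W K ^ (N + 1))).symm.toLinearMap, fun x => ?_⟩
  have := hΦ 1 x
  rw [one_mul] at this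
  exact this.symm

end DiffOps

section Correspondences

variable {p : ℕ} {K : Type*} [Field K] [Fact p.Prime] [CharP K p]

/-! ### Power towers -/

theorem PowerTower.ext' {V W : PowerTower p K} (h : ∀ n, V.W n = W.W n) : V = W := by
  obtain ⟨V, _⟩ := V
  obtain ⟨W, _⟩ := W
  obtain rfl : V = W := funext h
  rfl

theorem PowerTower.powField_le (W : PowerTower p K) (n : ℕ) : powField p K n ≤ W.W n := by
  rw [W.eq_sup n n le_rfl]
  exact le_sup_right

theorem PowerTower.antitone (W : PowerTower p K) : Antitone W.W := fun j i h => by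
  rw [W.eq_sup i j h]
  exact le_sup_left

theorem PowerTower.zero_eq_top (W : PowerTower p K) : W.W 0 = ⊤ :=
  top_le_iff.1 (powField_zero.symm.le.trans (W.powField_le 0))

theorem powField_le_comap_frobenius (n : ℕ) :
    powField p K n ≤ (powField p K (n + 1)).comap (frobenius K p) := by
  intro x hx
  obtain ⟨y, rfl⟩ := mem_powField.1 hx
  exact mem_powField.2 ⟨y, by rw [frobenius_def, ← pow_mul, ← pow_succ]⟩

theorem PowerTower.pow_mem (W : PowerTower p K) {n : ℕ} {x : K} (hx : x ∈ W.W n) :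
    x ^ p ∈ W.W (n + 1) := by
  have h : W.W n ≤ (W.W (n + 1)).comap (frobenius K p) := by
    rw [W.eq_sup (n + 1) n n.le_succ]
    refine sup_le (fun y hy => _root_.pow_mem hy p) ?_
    exact (powField_le_comap_frobenius n).trans fun y hy => W.powField_le _ hy
  exact h hx

theorem PowerTower.ann_relTangentAlg (W : PowerTower p K) (n : ℕ) :
    (relTangentAlg p (W.W n) (W.W (n + 1))).ann = W.W (n + 1) :=
  DiffCorr.ann_relTangentAlg (W.antitone n.le_succ) fun _ hx => W.pow_mem hx

theorem relTangent_inf_le {L M N : Subfield K} (hM : M ≤ L) (hN : N ≤ L) :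
    relTangent L M ⊓ relTangent L N ≤ relTangent L (M ⊔ N) := by
  rintro δ ⟨h1, h2⟩ x hx
  have h : M ⊔ N ≤ (constants {δ}).map L.subtype := by
    refine sup_le (fun y hy => ⟨⟨y, hM hy⟩, ?_, rfl⟩) fun y hy => ⟨⟨y, hN hy⟩, ?_, rfl⟩
    · rintro _ rfl; exact h1 _ hy
    · rintro _ rfl; exact h2 _ hy
  obtain ⟨y, hy, hyx⟩ := h hx
  obtain rfl : y = x := Subtype.ext hyx
  exact hy δ rfl

/-! ### Power towers and Jacobson sequences -/

/-- The Jacobson sequence of relative tangent bundles of a power tower. -/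
def PowerTower.toJacobsonSeq (W : PowerTower p K) : JacobsonSeq p K where
  F n := relTangentAlg p (W.W n) (W.W (n + 1))
  base_zero := W.zero_eq_top
  base_succ n := (W.ann_relTangentAlg n).symm
  inf_eq_bot n := by
    rw [eq_bot_iff]
    have hle : W.W (n + 2) ≤ W.W (n + 1) := W.antitone (Nat.le_succ _)
    refine (relTangent_inf_le hle (W.powField_le (n + 1))).trans ?_
    rw [← W.eq_sup (n + 2) (n + 1) (Nat.le_succ _)]
    intro δ hδ
    exact Derivation.ext fun x => hδ x x.2

theorem JacobsonSeq.powField_le_base (𝓕 : JacobsonSeq p K) (n : ℕ) :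
    powField p K n ≤ (𝓕.F n).base := by
  induction n with
  | zero => rw [𝓕.base_zero]; exact le_top
  | succ n ih =>
    rw [𝓕.base_succ]
    intro x hx
    obtain ⟨y, rfl⟩ := mem_powField.1 hx
    rw [pow_succ, pow_mul]
    exact pow_mem_ann _ (ih (pow_mem_powField n y))

theorem JacobsonSeq.finite_space (hK : (⊤ : IntermediateField (perfField p K) K).FG)
    (𝓕 : JacobsonSeq p K) (n : ℕ) : Module.Finite (𝓕.F n).base (𝓕.F n).space :=
  DiffCorr.finite_space hK _ (𝓕.powField_le_base n)

/-- The condition `𝓕 ∩ T_{L/K^{p^n}} = 0` leaves no derivation of `L` over `Ann 𝓕 · K^{p^n}`, so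
that field is `L`. -/
theorem JacobsonSeq.base_eq_sup (hK : (⊤ : IntermediateField (perfField p K) K).FG)
    (𝓕 : JacobsonSeq p K) (n : ℕ) :
    (𝓕.F n).base = (𝓕.F n).ann ⊔ powField p K n := by
  have hle : (𝓕.F n).ann ⊔ powField p K n ≤ (𝓕.F n).base :=
    sup_le (ann_le_base _) (𝓕.powField_le_base n)
  refine le_antisymm ?_ hle
  cases n with
  | zero => rw [powField_zero, sup_top_eq]; exact le_top
  | succ n =>
    have hzero : ∀ δ ∈ relTangent (𝓕.F (n + 1)).base
        ((𝓕.F (n + 1)).ann ⊔ powField p K (n + 1)), δ = 0 := by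
      intro δ hδ
      have hmem : δ ∈ (𝓕.F (n + 1)).space ⊓
          relTangent (𝓕.F (n + 1)).base (powField p K (n + 1)) := by
        refine ⟨?_, fun y hy => hδ y ((le_sup_right : powField p K (n + 1) ≤ _) hy)⟩
        have := 𝓕.finite_space hK (n + 1)
        rw [← relTangent_ann]
        exact fun y hy => hδ y ((le_sup_left : (𝓕.F (n + 1)).ann ≤ _) hy)
      rwa [𝓕.inf_eq_bot n, Submodule.mem_bot] at hmem
    rw [← DiffCorr.ann_relTangentAlg hle
      fun x hx => (le_sup_left : _ ≤ (𝓕.F (n + 1)).ann ⊔ powField p K (n + 1)) (pow_mem_ann _ hx)]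
    exact fun x hx => ⟨hx, fun δ hδ => DFunLike.congr_fun (hzero δ hδ) _⟩

/-- The power tower of iterated annihilators of a Jacobson sequence. -/
def JacobsonSeq.toPowerTower (hK : (⊤ : IntermediateField (perfField p K) K).FG)
    (𝓕 : JacobsonSeq p K) : PowerTower p K where
  W n := (𝓕.F n).base
  eq_sup i j h := by
    induction i, h using Nat.le_induction with
    | base => exact (sup_eq_left.2 (𝓕.powField_le_base j)).symm
    | succ i h ih =>
      rw [ih, 𝓕.base_eq_sup hK i, sup_assoc, sup_eq_right.2 (powField_antitone h), 𝓕.base_succ]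

/-! ### Power towers and rings of differential operators -/

theorem DiffSubalg.ext' {C D : DiffSubalg p K} (h : C.ops = D.ops) : C = D := by
  obtain ⟨C, _, _⟩ := C
  obtain ⟨D, _, _⟩ := D
  obtain rfl : C = D := h
  rfl

theorem PowerTower.monotone_linearOps (W : PowerTower p K) :
    Monotone fun n => linearOps (W.W n) := fun _ _ h => linearOps_antitone (W.antitone h)

theorem PowerTower.mem_iSup_linearOps (W : PowerTower p K) {T : AddMonoid.End K} :
    T ∈ ⨆ n, linearOps (W.W n) ↔ ∃ n, T ∈ linearOps (W.W n) :=
  Subring.mem_iSup_of_directed W.monotone_linearOps.directed_le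

theorem perfField_le_of_powField_le {W : Subfield K} {n : ℕ} (h : powField p K n ≤ W) :
    perfField p K ≤ W := (perfField_le_powField n).trans h

/-- For `W ⊇ K^{p^n}` every `W`-linear operator is a differential operator. -/
theorem diffOps_eq_linearOps (hK : (⊤ : IntermediateField (perfField p K) K).FG)
    {W : Subfield K} {n : ℕ} (h : powField p K n ≤ W) : diffOps W = linearOps W := by
  have := essFiniteType_of_perfField_le hK (perfField_le_of_powField_le h)
  exact (diffOps_subset_linearOps W).antisymm fun T hT =>
    mem_diffOps_of_mem_linearOps p hT (linearOps_antitone h hT)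

/-- The ring of operators that are linear over some member of a power tower. -/
def PowerTower.toDiffSubalg (hK : (⊤ : IntermediateField (perfField p K) K).FG)
    (W : PowerTower p K) : DiffSubalg p K where
  ops := ⨆ n, linearOps (W.W n)
  mulLeft_mem a := W.mem_iSup_linearOps.2 ⟨0, mulLeft_mem_linearOps _ a⟩
  le_diffOps := by
    intro T hT
    obtain ⟨n, hn⟩ := W.mem_iSup_linearOps.1 hT
    have := essFiniteType_of_perfField_le hK le_rfl
    exact mem_diffOps_of_mem_linearOps p
      (linearOps_antitone (perfField_le_of_powField_le (W.powField_le n)) hn)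
      (linearOps_antitone (W.powField_le n) hn)

theorem DiffSubalg.linearOps_commutant (hK : (⊤ : IntermediateField (perfField p K) K).FG)
    (𝓓 : DiffSubalg p K) (n : ℕ) :
    linearOps (commutant (𝓓.ops ⊓ linearOps (powField p K n))) =
      𝓓.ops ⊓ linearOps (powField p K n) := by
  have := finiteDimensional_of_powField_le hK (le_refl (powField p K n))
  exact DiffCorr.linearOps_commutant (E := powField p K n) _
    (fun a => ⟨𝓓.mulLeft_mem a, mulLeft_mem_linearOps _ a⟩) inf_le_right

/-- The power tower of a ring of differential operators: its `n`-th member is the commutant of the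
`K^{p^n}`-linear operators in the ring. -/
noncomputable def DiffSubalg.toPowerTower (hK : (⊤ : IntermediateField (perfField p K) K).FG)
    (𝓓 : DiffSubalg p K) : PowerTower p K where
  W n := commutant (𝓓.ops ⊓ linearOps (powField p K n))
  eq_sup i j h := by
    apply linearOps_injective
    rw [linearOps_sup, 𝓓.linearOps_commutant hK, 𝓓.linearOps_commutant hK, inf_assoc,
      inf_eq_right.2 (linearOps_antitone (powField_antitone h))]

/-- The `K^{p^n}`-linear operators in the ring of a power tower are the `W n`-linear ones, which is
how the tower is recovered. -/
theorem PowerTower.iSup_linearOps_inf (W : PowerTower p K) (n : ℕ) :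
    (⨆ m, linearOps (W.W m)) ⊓ linearOps (powField p K n) = linearOps (W.W n) := by
  apply le_antisymm
  · rintro T ⟨hT, hTn⟩
    obtain ⟨m, hm⟩ := W.mem_iSup_linearOps.1 hT
    rcases le_total n m with h | h
    · rw [W.eq_sup m n h, linearOps_sup]
      exact ⟨hm, hTn⟩
    · exact W.monotone_linearOps h hm
  · exact le_inf (le_iSup (fun m => linearOps (W.W m)) n) (linearOps_antitone (W.powField_le n))

/-- Power towers correspond to rings of differential operators. -/
noncomputable def diffEquiv (hK : (⊤ : IntermediateField (perfField p K) K).FG) :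
    PowerTower p K ≃ DiffSubalg p K where
  toFun := PowerTower.toDiffSubalg hK
  invFun := DiffSubalg.toPowerTower hK
  left_inv W := PowerTower.ext' fun n => by
    change commutant ((⨆ m, linearOps (W.W m)) ⊓ linearOps (powField p K n)) = W.W n
    rw [W.iSup_linearOps_inf, commutant_linearOps]
  right_inv 𝓓 := DiffSubalg.ext' <| by
    ext T
    refine (PowerTower.mem_iSup_linearOps (𝓓.toPowerTower hK)).trans ?_
    change (∃ n, T ∈ linearOps (commutant (𝓓.ops ⊓ linearOps (powField p K n)))) ↔ _
    simp only [𝓓.linearOps_commutant hK]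
    refine ⟨fun ⟨n, h⟩ => h.1, fun h => ?_⟩
    obtain ⟨n, hn⟩ := Set.mem_iUnion.1 (𝓓.le_diffOps h)
    exact ⟨n, h, diffOpsLE_subset_linearOps p _ n hn⟩

/-! ### Unpacking -/

/-- An operator linear over `W m`, `m > n`, restricts on `W n` to a derivation vanishing on `W m`
and on `(W n) ^ p`, thus on `W (n + 1)`; conversely a derivation over `W (n + 1)` extends to a linear
operator on `K`. -/
theorem unpackAt_toDiffSubalg (hK : (⊤ : IntermediateField (perfField p K) K).FG)
    (W : PowerTower p K) (n : ℕ) :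
    unpackAt (W.toDiffSubalg hK) (W.W n) = relTangentAlg p (W.W n) (W.W (n + 1)) := by
  have hle : W.W (n + 1) ≤ W.W n := W.antitone n.le_succ
  have h : ∀ δ : Derivation ℤ (W.W n) (W.W n),
      derivToOp (W.W n) δ ∈ differential (W.W n) '' ((W.toDiffSubalg hK).ops : Set _) ↔
        δ ∈ relTangent (W.W n) (W.W (n + 1)) := by
    intro δ
    constructor
    · rintro ⟨T, hT, hδ⟩
      have hTδ : ∀ x : W.W n, T (x : K) = ((δ x : W.W n) : K) := fun x => DFunLike.congr_fun hδ x
      obtain ⟨m, hm⟩ := W.mem_iSup_linearOps.1 hT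
      have hm' := W.monotone_linearOps (Nat.le_max_left m (n + 1)) hm
      have hmn := Nat.le_max_right m (n + 1)
      set l := max m (n + 1)
      rw [W.eq_sup l (n + 1) hmn]
      apply relTangent_inf_le ((W.antitone hmn).trans hle) ((W.powField_le (n + 1)).trans hle)
      constructor
      · intro x hx
        have h1 := hm' _ hx 1
        have h2 : T 1 = 0 := by
          have := hTδ 1
          rwa [Derivation.map_one_eq_zero] at this
        rw [mul_one, hTδ, h2, mul_zero] at h1
        exact Subtype.ext h1
      · intro x hx
        obtain ⟨y, hy⟩ := mem_powField.1 hx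
        have hxy : x = (⟨y ^ p ^ n, W.powField_le n (pow_mem_powField n y)⟩ : W.W n) ^ p := by
          apply Subtype.ext
          change (x : K) = (y ^ p ^ n) ^ p
          rw [← pow_mul, ← pow_succ]
          exact hy.symm
        rw [hxy]
        exact derivation_pow_char p δ _
    · intro hδ
      have hlin : ∀ w (hw : w ∈ W.W (n + 1)) (x : W.W n),
          δ (⟨w, hle hw⟩ * x) = ⟨w, hle hw⟩ * δ x := fun w hw x => by
        rw [Derivation.leibniz, hδ ⟨w, hle hw⟩ hw, smul_zero, add_zero, smul_eq_mul]
      let V : Submodule (W.W (n + 1)) K :=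
        { carrier := W.W n
          zero_mem' := zero_mem _
          add_mem' := add_mem
          smul_mem' := fun c x hx => mul_mem (hle c.2) hx }
      let f : V →ₗ[W.W (n + 1)] K :=
        { toFun := fun x => (δ ⟨x, x.2⟩ : W.W n)
          map_add' := fun x y => congrArg Subtype.val (map_add δ (⟨x, x.2⟩ : W.W n) ⟨y, y.2⟩)
          map_smul' := fun c x => congrArg Subtype.val (hlin c c.2 ⟨x, x.2⟩) }
      obtain ⟨T, hT, hTf⟩ := exists_linearOps_extend (W.W (n + 1)) V f
      refine ⟨T, W.mem_iSup_linearOps.2 ⟨n + 1, hT⟩, ?_⟩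
      ext x
      exact hTf ⟨x, x.2⟩
  exact PLieAlg.mk_eq_mk (Submodule.ext h)

theorem unpackField_toDiffSubalg (hK : (⊤ : IntermediateField (perfField p K) K).FG)
    (W : PowerTower p K) (n : ℕ) : unpackField (W.toDiffSubalg hK) n = W.W n := by
  induction n with
  | zero => exact W.zero_eq_top.symm
  | succ n ih =>
    change (unpackAt _ (unpackField _ n)).ann = _
    rw [ih, unpackAt_toDiffSubalg, W.ann_relTangentAlg]

/-! ### The tangent correspondence and ranks -/

theorem JacobsonSeq.ext' {𝓕 𝓖 : JacobsonSeq p K} (h : ∀ n, 𝓕.F n = 𝓖.F n) : 𝓕 = 𝓖 := by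
  obtain ⟨F, _, _, _⟩ := 𝓕
  obtain ⟨G, _, _, _⟩ := 𝓖
  obtain rfl : F = G := funext h
  rfl

/-- Power towers correspond to Jacobson sequences. -/
def tangentEquiv (hK : (⊤ : IntermediateField (perfField p K) K).FG) :
    PowerTower p K ≃ JacobsonSeq p K where
  toFun := PowerTower.toJacobsonSeq
  invFun := JacobsonSeq.toPowerTower hK
  left_inv _ := rfl
  right_inv 𝓕 := JacobsonSeq.ext' fun n => by
    have := 𝓕.finite_space hK n
    change relTangentAlg p (𝓕.F n).base (𝓕.F (n + 1)).base = _
    rw [𝓕.base_succ, relTangentAlg_ann]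

/-- If `x i` generate `W n` over `W (n + 1)`, then the `x i ^ p` generate `W (n + 1)` over
`W (n + 2)`, because `W (n + 1)` is the compositum of `W (n + 2)` and `K^{p^(n + 1)}`. -/
theorem JacobsonSeq.rank_succ_le (hK : (⊤ : IntermediateField (perfField p K) K).FG)
    (𝓕 : JacobsonSeq p K) (n : ℕ) : (𝓕.F (n + 1)).rank ≤ (𝓕.F n).rank := by
  have := 𝓕.finite_space hK n
  obtain ⟨x, hx, hgen⟩ := exists_generators (𝓕.F n)
  have hy : ∀ i, x i ^ p ∈ (𝓕.F (n + 1)).base := fun i => by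
    rw [𝓕.base_succ]
    exact pow_mem_ann _ (hx i)
  let y : Fin (𝓕.F n).rank → (𝓕.F (n + 1)).base := fun i => ⟨x i ^ p, hy i⟩
  let M := (𝓕.F (n + 1)).ann.comap (𝓕.F (n + 1)).base.subtype
  let N := (M ⊔ Subfield.closure (Set.range y)).map (𝓕.F (n + 1)).base.subtype
  have hann : (𝓕.F (n + 1)).ann ≤ N := fun z hz =>
    ⟨⟨z, ann_le_base _ hz⟩, (le_sup_left : M ≤ M ⊔ Subfield.closure (Set.range y)) hz, rfl⟩
  have hbase : (𝓕.F n).base ≤ N.comap (frobenius K p) := by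
    refine hgen.trans (sup_le ?_ (Subfield.closure_le.2 ?_))
    · rw [← 𝓕.base_succ]
      exact fun z hz => hann (pow_mem_ann _ hz)
    · rintro _ ⟨i, rfl⟩
      exact ⟨y i, (le_sup_right : _ ≤ M ⊔ Subfield.closure (Set.range y))
        (Subfield.subset_closure ⟨i, rfl⟩), rfl⟩
  have hN : (𝓕.F (n + 1)).base ≤ N := by
    rw [𝓕.base_eq_sup hK (n + 1)]
    refine sup_le hann fun z hz => ?_
    obtain ⟨w, rfl⟩ := mem_powField.1 hz
    rw [pow_succ, pow_mul]
    exact hbase (𝓕.powField_le_base n (pow_mem_powField n w))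
  have htop : ⊤ ≤ M ⊔ Subfield.closure (Set.range y) := by
    intro z _
    obtain ⟨w, hw, hwz⟩ := hN z.2
    obtain rfl : w = z := Subtype.ext hwz
    exact hw
  have h := (finite_and_finrank_le_card htop (𝓕.F (n + 1)).space fun δ hδ z hz =>
    hz.2 δ hδ).2
  rwa [Fintype.card_fin] at h

end Correspondences

end DiffCorr

theorem theorem4 (p : ℕ) (K : Type*) [Field K] [Fact p.Prime] [CharP K p]
    (hK : (⊤ : IntermediateField (DiffCorr.perfField p K) K).FG) :
    ∃ (tangent : DiffCorr.PowerTower p K ≃ DiffCorr.JacobsonSeq p K)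
      (diff : DiffCorr.PowerTower p K ≃ DiffCorr.DiffSubalg p K)
      (unpacking : DiffCorr.DiffSubalg p K ≃ DiffCorr.JacobsonSeq p K),
      -- the iterated tangent bundle
      (∀ (W : DiffCorr.PowerTower p K) (n : ℕ),
        (tangent W).F n = DiffCorr.relTangentAlg p (W.W n) (W.W (n + 1))) ∧
      -- the iterated annihilator
      (∀ 𝓕 : DiffCorr.JacobsonSeq p K, (tangent.symm 𝓕).W 0 = ⊤ ∧
        ∀ n : ℕ, (tangent.symm 𝓕).W (n + 1) = (𝓕.F n).ann) ∧
      -- the algebra of relative differential operators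
      (∀ W : DiffCorr.PowerTower p K,
        ((diff W).ops : Set (AddMonoid.End K)) = ⋃ n : ℕ, DiffCorr.diffOps (W.W n)) ∧
      -- the unpacking
      (∀ (𝓓 : DiffCorr.DiffSubalg p K) (n : ℕ),
        (unpacking 𝓓).F n = DiffCorr.unpack 𝓓 n ∧
        (unpacking 𝓓).F n = DiffCorr.unpackAt 𝓓 ((diff.symm 𝓓).W n)) ∧
      -- the three bijections are compatible
      (∀ W : DiffCorr.PowerTower p K, unpacking (diff W) = tangent W) ∧
      -- the ranks
      (∀ (𝓕 : DiffCorr.JacobsonSeq p K) (n : ℕ),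
        Module.Finite (𝓕.F n).base (𝓕.F n).space ∧
        (𝓕.F (n + 1)).rank ≤ (𝓕.F n).rank ∧
        p ^ (𝓕.F n).rank =
          Subfield.relfinrank ((tangent.symm 𝓕).W (n + 1)) ((tangent.symm 𝓕).W n)) := by
  refine ⟨DiffCorr.tangentEquiv hK, DiffCorr.diffEquiv hK,
    (DiffCorr.diffEquiv hK).symm.trans (DiffCorr.tangentEquiv hK), fun _ _ => rfl,
    fun 𝓕 => ⟨𝓕.base_zero, 𝓕.base_succ⟩, fun W => ?_, fun 𝓓 n => ?_, fun W => ?_, fun 𝓕 n => ?_⟩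
  · ext T
    simp only [DiffCorr.diffOps_eq_linearOps hK (W.powField_le _), Set.mem_iUnion]
    exact W.mem_iSup_linearOps
  · obtain ⟨W, rfl⟩ := (DiffCorr.diffEquiv hK).surjective 𝓓
    rw [Equiv.trans_apply, Equiv.symm_apply_apply]
    have h := DiffCorr.unpackAt_toDiffSubalg hK W n
    refine ⟨?_, h.symm⟩
    change _ = DiffCorr.unpackAt _ (DiffCorr.unpackField (W.toDiffSubalg hK) n)
    rw [DiffCorr.unpackField_toDiffSubalg]
    exact h.symm
  · rw [Equiv.trans_apply, Equiv.symm_apply_apply]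
  · have := 𝓕.finite_space hK n
    refine ⟨this, 𝓕.rank_succ_le hK n, ?_⟩
    rw [DiffCorr.pow_rank_eq_relfinrank, ← 𝓕.base_succ]
    rfl
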